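/- Let $M$ be a closed (compact, without boundary) connected smooth $n$-manifold with a smooth action of the torus $T^k=(S^1)^k$. For $x\in M$ let $\mathrm{ev}\colon T^k\to M$, $\mathrm{ev}(t)=tx$, be the orbit map at $x$. The action is called injective if $\mathrm{ev}_\#\colon \mathbb Z^k=\pi_1(T^k,1)\to\pi=\pi_1(M,x)$ is injective (this does not depend on $x$); the image of $\mathrm{ev}_\#$ is always central in $\pi$, so with $Q=\pi/\mathrm{ev}_\#(\mathbb Z^k)$ an injective action gives a central extension $$1\to\mathbb Z^k\to\pi\to Q\to 1.$$ The action is called injective-splitting if it is injective and there is a normal subgroup $Q'$ of finite index in $Q$ such that the induced extension $1\to\mathbb Z^k\to\pi'\to Q'\to 1$, where $\pi'\le\pi$ is the preimage of $Q'$, splits, that is, $\pi'=\mathbb Z^k\times Q'$. The action is called homologically injective if $\mathrm{ev}_*\colon H_1(T^k;\mathbb Z)\to H_1(M;\mathbb Z)$ is injective. Write $b_j=\operatorname{rank}H_j(M;\mathbb Z)$. Suppose that the $T^k$-action on $M$ is injective-splitting. Then, for every orbit map, $\mathrm{ev}_*\colon H_j(T^k;\mathbb Z)\to H_j(M;\mathbb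 Z)$ is injective for every $j\ge 0$, and the following hold. (i) $\binom{k}{j}\le b_j$ for every $j\ge 0$. In particular the Halperin–Carlsson inequality $2^k\le\sum_{j=0}^{n}b_j$ holds. (ii) The $T^k$-action is homologically injective. -/

import Mathlib

open scoped Manifold ContDiff

noncomputable section

namespace TorusAction

open CategoryTheory

/-- The torus `T^k = (S^1)^k`, with Mathlib's product topology, group and charted space
structures. -/
abbrev Torus (k : ℕ) : Type := Fin k → Circle

/-- The (boundaryless) model with corners of the torus: the `k`-fold product of `𝓡 1`. -/
abbrev torusModel (k : ℕ) :
    ModelWithCorners ℝ (Fin k → EuclideanSpace ℝ (Fin 1))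
      (ModelPi fun _ : Fin k => EuclideanSpace ℝ (Fin 1)) :=
  ModelWithCorners.pi fun _ : Fin k => 𝓡 1

section Homology

/-- Singular homology `H_j(X; ℤ)`. -/
abbrev homology (j : ℕ) (X : Type) [TopologicalSpace X] : ModuleCat.{0} ℤ :=
  ((AlgebraicTopology.singularHomologyFunctor (ModuleCat.{0} ℤ) j).obj
    (ModuleCat.of ℤ ℤ)).obj (TopCat.of X)

/-- The map induced on `H_j( · ; ℤ)` by a continuous map. -/
def homologyMap (j : ℕ) {X Y : Type} [TopologicalSpace X] [TopologicalSpace Y] (f : C(X, Y)) :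
    homology j X →ₗ[ℤ] homology j Y :=
  (((AlgebraicTopology.singularHomologyFunctor (ModuleCat.{0} ℤ) j).obj
    (ModuleCat.of ℤ ℤ)).map (TopCat.ofHom f)).hom

/-- The `j`-th Betti number `b_j = rank H_j(X; ℤ)`, as a cardinal: no convention is needed
for groups of infinite rank. -/
def betti (j : ℕ) (X : Type) [TopologicalSpace X] : Cardinal.{0} :=
  Module.rank ℤ (homology j X)

end Homology

section Action

variable (k : ℕ) {M : Type} [TopologicalSpace M] [MulAction (Torus k) M]
  [ContinuousSMul (Torus k) M]

/-- The orbit map `ev : T^k → M`, `ev t = t • x`. -/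
def ev (x : M) : C(Torus k, M) where
  toFun t := t • x
  continuous_toFun := continuous_id.smul continuous_const

/-- The homomorphism `ev_# : π₁(T^k, 1) → π₁(M, x)` induced by the orbit map. -/
def evPi (x : M) : FundamentalGroup (Torus k) 1 →* FundamentalGroup M x :=
  FundamentalGroup.mapOfEq (ev k x) (one_smul (Torus k) x)

/-- The image of `ev_#` is central in `π₁(M, x)`. -/
theorem evPi_commute (x : M) (g : FundamentalGroup (Torus k) 1) (d : FundamentalGroup M x) :
    evPi k x g * d = d * evPi k x g := by
  let act : C(Torus k × M, M) := ⟨fun p => p.1 • p.2, continuous_smul⟩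
  let A : FundamentalGroup (Torus k × M) (1, x) →* FundamentalGroup M x :=
    FundamentalGroup.mapOfEq act (one_smul (Torus k) x)
  let g' : FundamentalGroup (Torus k × M) (1, x) :=
    Path.Homotopic.prod g (Path.Homotopic.Quotient.refl x)
  let d' : FundamentalGroup (Torus k × M) (1, x) :=
    Path.Homotopic.prod (Path.Homotopic.Quotient.refl (1 : Torus k)) d
  have hg : A g' = evPi k x g := by
    refine (FundamentalGroup.mapOfEq_apply _ _ _).trans
      (Eq.trans ?_ (FundamentalGroup.mapOfEq_apply _ _ _).symm)
    simp only [g']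
    induction g using Path.Homotopic.Quotient.ind with | mk g =>
    rfl
  have hd : A d' = d := by
    simp only [A, d', FundamentalGroup.mapOfEq_apply]
    induction d using Path.Homotopic.Quotient.ind with | mk d =>
    refine congrArg Path.Homotopic.Quotient.mk (Path.ext (funext fun t => ?_))
    exact one_smul (Torus k) (d t)
  have hc : g' * d' = d' * g' := by
    simp only [FundamentalGroup.mul_def, g', d']
    refine (Path.Homotopic.comp_prod_eq_prod_comp _ _ _ _).trans
      (Eq.trans ?_ (Path.Homotopic.comp_prod_eq_prod_comp _ _ _ _).symm)
    congr 1
    · exact (mul_one (M := FundamentalGroup (Torus k) 1) g).trans (one_mul g).symm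
    · exact (one_mul (M := FundamentalGroup M x) d).trans (mul_one d).symm
  rw [← hg, ← hd, ← map_mul, hc, map_mul]

instance evPi_range_normal (x : M) : (evPi k x).range.Normal where
  conj_mem := by
    rintro _ ⟨g, rfl⟩ d
    exact ⟨g, by rw [← evPi_commute, mul_inv_cancel_right]⟩

/-- The quotient `Q = π₁(M, x) / ev_#(π₁(T^k))`. -/
abbrev Q (x : M) : Type := FundamentalGroup M x ⧸ (evPi k x).range

/-- The action is injective (at the base point `x`): `ev_#` is injective. -/
def IsInjectiveAction (x : M) : Prop := Function.Injective (evPi k x)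

/-- The action is injective-splitting (at the base point `x`): it is injective, so that there is a
central extension `1 → ℤ^k → π₁(M, x) → Q → 1` with `ℤ^k = π₁(T^k)`, and for some normal subgroup
`Q'` of finite index in `Q` the induced extension `1 → ℤ^k → π' → Q' → 1`, where `π'` is the
preimage of `Q'`, has a section `s : Q' → π'` that is a homomorphism. -/
def IsInjectiveSplitting (x : M) : Prop :=
  IsInjectiveAction k x ∧
    ∃ Q' : Subgroup (Q k x), Q'.Normal ∧ Q'.FiniteIndex ∧
      ∃ s : Q' →* Q'.comap (QuotientGroup.mk' (evPi k x).range),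
        ∀ q : Q', ((s q : FundamentalGroup M x) : Q k x) = q

/-- The action is homologically injective (at the base point `x`): the map
`ev_* : H_1(T^k; ℤ) → H_1(M; ℤ)` is injective. -/
def IsHomologicallyInjective (x : M) : Prop :=
  Function.Injective (homologyMap 1 (ev k x))

end Action

end TorusAction

end

/-! The splitting gives a retraction of a finite-index subgroup of π₁(M) onto π₁(T^k). Since the
target is abelian, the transfer extends it to all of π₁(M), at the price that on the central image
of `evPi` it becomes multiplication by the index d (`exists_periods_hom`). Such a homomorphism is
realised by a map f : M → T^k, built as the exponential of a primitive of a path cocycle averaged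
with a partition of unity (`exists_torus_map`). Then f ∘ ev is homotopic to the d-th power map
(`homotopic_torusPow`). Once that map is injective on homology, so is ev_*, and the Betti bounds
follow from the ranks for T^k.

The power map is treated by adding one circle at a time. Simplices of X × S¹ are free ℤ-orbits of
simplices of X × ℝ, so τ − 1 on C(X × ℝ), followed by the map to C(X × S¹), is a short exact
sequence. As τ is homotopic to the identity, the long exact sequence breaks into pieces 0 →
H_{j+1}(X) → H_{j+1}(X × S¹) → H_j(X) → 0. Raising the circle to the d-th power multiplies the
quotient by d, which is harmless without torsion (`IsTorusLike.prod_circle`).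

Summing only over j ≤ n requires k ≤ n. If k > n, the derivative of the orbit map has a kernel, so a
line in ℝ^k fixes the point (`exists_fixed_line`). Along this line the lift of f would be constant,
yet it is a bounded term plus a linear one (`eq_zero_of_line_fixed`). -/

noncomputable section

namespace TorusAction

/-! ### Chains of a free ℤ-action -/

section Chains

open CategoryTheory Limits

section FreeAction

variable {S B : Type*} (τ : S ≃ S) (π : S → B)

/-- An element of the kernel is constant along τ-orbits. These are infinite by freeness, so finite
support forces it to vanish. -/
theorem injective_lmapDomain_sub_id (hfree : ∀ s (n : ℤ), (τ ^ n) s = s → n = 0) :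
    Function.Injective (Finsupp.lmapDomain ℤ ℤ τ - LinearMap.id : (S →₀ ℤ) →ₗ[ℤ] (S →₀ ℤ)) := by
  rw [injective_iff_map_eq_zero]
  intro x hx
  have hx' : Finsupp.mapDomain τ x = x := by
    simpa [sub_eq_zero] using hx
  have h1 : ∀ s, x (τ s) = x s := fun s => by
    conv_lhs => rw [← hx']
    exact Finsupp.mapDomain_apply τ.injective x s
  have h2 : ∀ (n : ℕ) s, x ((τ ^ (n : ℤ)) s) = x s := by
    intro n
    induction n with
    | zero => intro s; simp
    | succ n ih =>
      intro s
      rw [Nat.cast_succ, zpow_add_one, Equiv.Perm.mul_apply, ih, h1]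
  ext s
  by_contra hs
  have hinj : Function.Injective fun n : ℕ => (τ ^ (n : ℤ)) s := by
    intro m n hmn
    have : (τ ^ ((m : ℤ) - n)) s = s := by
      rw [sub_eq_neg_add, zpow_add, Equiv.Perm.mul_apply]
      dsimp only at hmn
      rw [hmn, ← Equiv.Perm.mul_apply, ← zpow_add]
      simp
    have := hfree _ _ this
    omega
  refine Set.infinite_range_of_injective hinj (x.support.finite_toSet.subset ?_)
  rintro _ ⟨n, rfl⟩
  simpa using (h2 n s).trans_ne hs

/-- For a section σ of π, each s lies in the same orbit as σ (π s). Hence every chain agrees, modulo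
the image of τ − 1, with its pushforward along σ ∘ π, which is zero as soon as its pushforward along
π is. -/
theorem exact_lmapDomain_sub_id (hsurj : Function.Surjective π)
    (hfib : ∀ s s', π s = π s' ↔ ∃ n : ℤ, s' = (τ ^ n) s) :
    Function.Exact (Finsupp.lmapDomain ℤ ℤ τ - LinearMap.id : (S →₀ ℤ) →ₗ[ℤ] (S →₀ ℤ))
      (Finsupp.lmapDomain ℤ ℤ π) := by
  set D : (S →₀ ℤ) →ₗ[ℤ] (S →₀ ℤ) := Finsupp.lmapDomain ℤ ℤ τ - LinearMap.id with hD
  have hπτ : ∀ s, π (τ s) = π s := fun s => ((hfib s (τ s)).2 ⟨1, by simp⟩).symm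
  have hs1 : ∀ s, Finsupp.single (τ s) (1 : ℤ) - Finsupp.single s 1 ∈ LinearMap.range D :=
    fun s => ⟨Finsupp.single s 1, by simp [hD]⟩
  have hsn : ∀ (n : ℤ) s,
      Finsupp.single ((τ ^ n) s) (1 : ℤ) - Finsupp.single s 1 ∈ LinearMap.range D := by
    intro n
    induction n with
    | zero => intro s; simp
    | succ n ih =>
      intro s
      rw [zpow_add_one, Equiv.Perm.mul_apply]
      simpa using add_mem (ih (τ s)) (hs1 s)
    | pred n ih =>
      intro s
      rw [zpow_sub_one, Equiv.Perm.mul_apply]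
      simpa using sub_mem (ih (τ⁻¹ s)) (hs1 (τ⁻¹ s))
  obtain ⟨σ, hσ⟩ := hsurj.hasRightInverse
  have key : ∀ x : S →₀ ℤ, Finsupp.mapDomain (σ ∘ π) x - x ∈ LinearMap.range D := by
    intro x
    induction x using Finsupp.induction_linear with
    | zero => simp
    | add x y hx hy =>
      rw [Finsupp.mapDomain_add]
      convert add_mem hx hy using 1
      abel
    | single s a =>
      obtain ⟨n, hn⟩ := (hfib s (σ (π s))).1 (hσ _).symm
      have := Submodule.smul_mem _ a (hsn n s)
      rw [← hn] at this
      simpa [smul_sub] using this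
  intro x
  constructor
  · intro hx
    have hx' : Finsupp.mapDomain π x = 0 := by simpa using hx
    have := key x
    rw [Finsupp.mapDomain_comp, hx'] at this
    simpa using this
  · rintro ⟨y, rfl⟩
    have : π ∘ τ = π := funext hπτ
    rw [hD, LinearMap.sub_apply, map_sub, sub_eq_zero]
    simp only [Finsupp.lmapDomain_apply, LinearMap.id_apply]
    rw [← Finsupp.mapDomain_comp, this]

end FreeAction

section SimplicialChains

open Simplicial

/-- Simplicial chains of a simplicial set are finitely supported functions on simplices. -/
def chainsEquiv (X : SSet.{0}) (n : ℕ) :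
    (X.chainComplex (ModuleCat.of ℤ ℤ)).X n ≅ ModuleCat.of ℤ (X _⦋n⦌ →₀ ℤ) :=
  (X.isColimitChainComplexXCofan (ModuleCat.of ℤ ℤ) n).coconePointUniqueUpToIso
    (ModuleCat.finsuppCoconeIsColimit ℤ ℤ (X _⦋n⦌))

theorem ι_chainsEquiv (X : SSet.{0}) (n : ℕ) (x : X _⦋n⦌) :
    X.ιChainComplex x ≫ (chainsEquiv X n).hom = ModuleCat.ofHom (Finsupp.lsingle x) :=
  IsColimit.comp_coconePointUniqueUpToIso_hom _ _ (Discrete.mk x)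

theorem chainsEquiv_naturality {X Y : SSet.{0}} (f : X ⟶ Y) (n : ℕ) :
    (SSet.chainComplexMap f (ModuleCat.of ℤ ℤ)).f n ≫ (chainsEquiv Y n).hom =
      (chainsEquiv X n).hom ≫ ModuleCat.ofHom (Finsupp.lmapDomain ℤ ℤ (f.app _)) := by
  refine SSet.chainComplex_hom_ext fun x => ?_
  rw [SSet.ι_chainComplexMap_f_assoc, ι_chainsEquiv, ← Category.assoc, ι_chainsEquiv]
  ext
  simp

/-- The complex `C(Y) ⟶ C(Y) ⟶ C(B)` given by `τ - 1` and a `τ`-invariant map `Y ⟶ B`. -/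
@[simps]
def orbitShortComplex {Y B : SSet.{0}} (τ : Y ⟶ Y) (p : Y ⟶ B) (h : τ ≫ p = p) :
    ShortComplex (ChainComplex (ModuleCat.{0} ℤ) ℕ) where
  X₁ := Y.chainComplex (ModuleCat.of ℤ ℤ)
  X₂ := Y.chainComplex (ModuleCat.of ℤ ℤ)
  X₃ := B.chainComplex (ModuleCat.of ℤ ℤ)
  f := SSet.chainComplexMap τ _ - 𝟙 _
  g := SSet.chainComplexMap p _
  zero := by
    rw [Preadditive.sub_comp, ← Functor.map_comp, h, Category.id_comp, sub_self]

theorem orbitShortComplex_shortExact {Y B : SSet.{0}} (τ : Y ⟶ Y) (p : Y ⟶ B) (h : τ ≫ p = p)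
    (e : ∀ n : ℕ, Y _⦋n⦌ ≃ Y _⦋n⦌) (he : ∀ n s, e n s = τ.app _ s)
    (hfree : ∀ n s (m : ℤ), (e n ^ m) s = s → m = 0)
    (hsurj : ∀ n : ℕ, Function.Surjective (p.app (.op ⦋n⦌)))
    (hfib : ∀ (n : ℕ) (s s' : Y _⦋n⦌), p.app _ s = p.app _ s' ↔ ∃ m : ℤ, s' = (e n ^ m) s) :
    (orbitShortComplex τ p h).ShortExact := by
  refine HomologicalComplex.shortExact_of_degreewise_shortExact _ fun n => ?_
  have he' : ⇑(e n) = τ.app (.op ⦋n⦌) := funext (he n)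
  have hex := exact_lmapDomain_sub_id (e n) (p.app (.op ⦋n⦌)) (hsurj n) (hfib n)
  let T : ShortComplex (ModuleCat.{0} ℤ) := ShortComplex.mk
    (ModuleCat.ofHom (Finsupp.lmapDomain ℤ ℤ (e n) - LinearMap.id))
    (ModuleCat.ofHom (Finsupp.lmapDomain ℤ ℤ (p.app (.op ⦋n⦌))))
    (by ext1; exact hex.linearMap_comp_eq_zero)
  have hT : T.ShortExact :=
    { exact := (ShortComplex.ShortExact.moduleCat_exact_iff_function_exact T).2 hex
      mono_f := (ModuleCat.mono_iff_injective _).2 (injective_lmapDomain_sub_id (e n) (hfree n))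
      epi_g := (ModuleCat.epi_iff_surjective _).2
        (Finsupp.mapDomain_surjective (hsurj n)) }
  have h₁ : (chainsEquiv Y n).inv ≫ (SSet.chainComplexMap τ (ModuleCat.of ℤ ℤ) - 𝟙 _).f n =
      T.f ≫ (chainsEquiv Y n).inv := by
    have := chainsEquiv_naturality τ n
    rw [← he'] at this
    rw [Iso.inv_comp_eq, ← Category.assoc, Iso.eq_comp_inv]
    rw [HomologicalComplex.sub_f_apply, Preadditive.sub_comp, this]
    refine Eq.trans ?_ (Preadditive.comp_sub (chainsEquiv Y n).hom
      (ModuleCat.ofHom (Finsupp.lmapDomain ℤ ℤ (e n))) (𝟙 _)).symm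
    rw [HomologicalComplex.id_f, Category.id_comp, Category.comp_id]
  have h₂ : (chainsEquiv Y n).inv ≫ (SSet.chainComplexMap p (ModuleCat.of ℤ ℤ)).f n =
      T.g ≫ (chainsEquiv B n).inv := by
    rw [Iso.inv_comp_eq, ← Category.assoc, Iso.eq_comp_inv]
    exact chainsEquiv_naturality p n
  exact ShortComplex.shortExact_of_iso (ShortComplex.isoMk (S₁ := T)
    (chainsEquiv Y n).symm (chainsEquiv Y n).symm (chainsEquiv B n).symm h₁ h₂) hT

end SimplicialChains

end Chains

open CategoryTheory Limits Real Topology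

/-! ### Singular chains and functoriality of homology -/

section SingularChains

/-- Integral singular chains. -/
abbrev singularChains (X : Type) [TopologicalSpace X] : ChainComplex (ModuleCat.{0} ℤ) ℕ :=
  (TopCat.toSSet.obj (TopCat.of X)).chainComplex (ModuleCat.of ℤ ℤ)

/-- The chain map induced by a continuous map. -/
abbrev singularChainsMap {X Y : Type} [TopologicalSpace X] [TopologicalSpace Y] (f : C(X, Y)) :
    singularChains X ⟶ singularChains Y :=
  SSet.chainComplexMap (TopCat.toSSet.map (TopCat.ofHom f)) (ModuleCat.of ℤ ℤ)

theorem singularChainsMap_comp {X Y Z : Type} [TopologicalSpace X] [TopologicalSpace Y]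
    [TopologicalSpace Z] (g : C(Y, Z)) (f : C(X, Y)) :
    singularChainsMap (g.comp f) = singularChainsMap f ≫ singularChainsMap g := by
  rw [singularChainsMap, TopCat.ofHom_comp, Functor.map_comp]
  exact CategoryTheory.Functor.map_comp _ _ _

end SingularChains

section HomologyMap

variable {X Y Z : Type} [TopologicalSpace X] [TopologicalSpace Y] [TopologicalSpace Z]

theorem homologyMap_id (j : ℕ) : homologyMap j (ContinuousMap.id X) = LinearMap.id := by
  rw [homologyMap]
  exact congrArg ModuleCat.Hom.hom (CategoryTheory.Functor.map_id _ _)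

theorem homologyMap_comp (j : ℕ) (g : C(Y, Z)) (f : C(X, Y)) :
    homologyMap j (g.comp f) = homologyMap j g ∘ₗ homologyMap j f := by
  rw [homologyMap, TopCat.ofHom_comp]
  exact congrArg ModuleCat.Hom.hom (Functor.map_comp _ _ _)

theorem homologyMap_comp_apply (j : ℕ) (g : C(Y, Z)) (f : C(X, Y)) (c : homology j X) :
    homologyMap j (g.comp f) c = homologyMap j g (homologyMap j f c) := by
  rw [homologyMap_comp]; rfl

theorem homologyMap_eq_of_homotopic (j : ℕ) {f g : C(X, Y)} (h : f.Homotopic g) :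
    homologyMap j f = homologyMap j g := by
  obtain ⟨H⟩ := h
  exact congrArg ModuleCat.Hom.hom
    (TopCat.Homotopy.congr_homologyMap_singularChainComplexFunctor
      (f := TopCat.ofHom f) (g := TopCat.ofHom g) H (ModuleCat.of ℤ ℤ) j)

/-- A homotopy equivalence induces an isomorphism in homology. -/
def homologyEquiv (j : ℕ) (e : ContinuousMap.HomotopyEquiv X Y) :
    homology j X ≃ₗ[ℤ] homology j Y :=
  LinearEquiv.ofLinearMap (homologyMap j e.toFun) (homologyMap j e.invFun)
    (by rw [← homologyMap_comp, homologyMap_eq_of_homotopic j e.right_inv, homologyMap_id])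
    (by rw [← homologyMap_comp, homologyMap_eq_of_homotopic j e.left_inv, homologyMap_id])

end HomologyMap

/-! ### Homology of X × S¹ through the covering X × ℝ -/

section CircleBundle

/-- A nullhomotopy, run backwards, starts at a constant map, which has a constant lift; homotopy
lifting carries this to a lift of f. -/
theorem exists_lift_circle {A : Type*} [TopologicalSpace A] [ContractibleSpace A]
    (f : C(A, Circle)) : ∃ g : C(A, ℝ), ∀ a, Circle.exp (g a) = f a := by
  obtain ⟨z, ⟨H⟩⟩ := (id_nullhomotopic A).comp_right f
  obtain ⟨v, hv⟩ := Circle.exp_surjective z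
  let L := Circle.isCoveringMap_exp.liftHomotopy H.symm.toContinuousMap (ContinuousMap.const A v)
    (fun a => by simpa using hv.symm)
  refine ⟨L.comp ((ContinuousMap.const A 1).prodMk (ContinuousMap.id A)), fun a => ?_⟩
  have := congrFun (Circle.isCoveringMap_exp.liftHomotopy_lifts H.symm.toContinuousMap
    (ContinuousMap.const A v) (fun a => by simpa using hv.symm)) (1, a)
  exact this.trans (by simp)

variable (X : Type) [TopologicalSpace X]

/-- The generator `(x, v) ↦ (x, v + 2π)` of the deck transformations of `X × ℝ → X × S¹`. -/
def shift : C(X × ℝ, X × ℝ) := ⟨fun p => (p.1, p.2 + 2 * π), by fun_prop⟩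

/-- The covering `X × ℝ → X × S¹`. -/
def unroll : C(X × ℝ, X × Circle) := ⟨fun p => (p.1, Circle.exp p.2), by fun_prop⟩

/-- Composition with `shift` as a permutation. -/
def shiftPerm (A : Type*) [TopologicalSpace A] : Equiv.Perm C(A, X × ℝ) where
  toFun s := (shift X).comp s
  invFun s := ⟨fun a => ((s a).1, (s a).2 - 2 * π), by fun_prop⟩
  left_inv s := by ext a <;> simp [shift]
  right_inv s := by ext a <;> simp [shift]

theorem shiftPerm_zpow_apply (A : Type*) [TopologicalSpace A] (m : ℤ) (s : C(A, X × ℝ)) (a : A) :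
    (shiftPerm X A ^ m) s a = ((s a).1, (s a).2 + m * (2 * π)) := by
  induction m generalizing s with
  | zero => simp
  | succ n ih =>
    rw [zpow_add_one, Equiv.Perm.mul_apply, ih]
    simp [shiftPerm, shift]; ring
  | pred n ih =>
    rw [zpow_sub_one, Equiv.Perm.mul_apply, ih]
    have : (shiftPerm X A)⁻¹ s a = ((s a).1, (s a).2 - 2 * π) := rfl
    rw [this]
    simp; ring

theorem shiftPerm_free (A : Type*) [TopologicalSpace A] [Nonempty A] (s : C(A, X × ℝ)) (m : ℤ)
    (h : (shiftPerm X A ^ m) s = s) : m = 0 := by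
  have := congrArg Prod.snd (DFunLike.congr_fun h (Classical.arbitrary A))
  rw [shiftPerm_zpow_apply] at this
  simpa [pi_ne_zero] using this

theorem unroll_comp_surjective (A : Type*) [TopologicalSpace A] [ContractibleSpace A] :
    Function.Surjective fun s : C(A, X × ℝ) => (unroll X).comp s := by
  intro s
  obtain ⟨g, hg⟩ := exists_lift_circle (ContinuousMap.snd.comp s)
  exact ⟨(ContinuousMap.fst.comp s).prodMk g, by ext a <;> simp [unroll, hg]⟩

theorem unroll_comp_eq_iff (A : Type*) [TopologicalSpace A] [ConnectedSpace A]
    (s s' : C(A, X × ℝ)) : (unroll X).comp s = (unroll X).comp s' ↔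
      ∃ m : ℤ, s' = (shiftPerm X A ^ m) s := by
  constructor
  · intro h
    have h1 : ∀ a, (s a).1 = (s' a).1 := fun a =>
      congrArg (Prod.fst : X × Circle → X) (DFunLike.congr_fun h a)
    have h2 : ∀ a, Circle.exp (s a).2 = Circle.exp (s' a).2 :=
      fun a => congrArg Prod.snd (DFunLike.congr_fun h a)
    obtain ⟨m, hm⟩ := Circle.exp_eq_exp.1 (h2 (Classical.arbitrary A)).symm
    have := Circle.isCoveringMap_exp.eq_of_comp_eq (g₁ := fun a => (s' a).2)
      (g₂ := fun a => (s a).2 + m * (2 * π)) (by fun_prop) (by fun_prop)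
      (funext fun a => (h2 a).symm.trans (Circle.exp_eq_exp.2 ⟨-m, by push_cast; ring⟩))
      (Classical.arbitrary A) hm
    refine ⟨m, ContinuousMap.ext fun a => ?_⟩
    rw [shiftPerm_zpow_apply]
    exact Prod.ext (h1 a).symm (congrFun this a)
  · rintro ⟨m, rfl⟩
    ext1 a
    simp only [ContinuousMap.comp_apply, shiftPerm_zpow_apply, unroll, ContinuousMap.coe_mk]
    exact congrArg _ (Circle.exp_eq_exp.2 ⟨-m, by push_cast; ring⟩)

instance contractibleSpace_stdSimplex (n : ℕ) : ContractibleSpace (stdSimplex ℝ (Fin (n + 1))) :=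
  (convex_stdSimplex ℝ _).contractibleSpace (Set.nonempty_coe_sort.1 inferInstance)

theorem unroll_comp_shift : (unroll X).comp (shift X) = unroll X := by
  ext p <;> simp [unroll, shift]

theorem permCongr_zpow {α β : Type*} (e : α ≃ β) (p : Equiv.Perm α) (m : ℤ) :
    e.permCongr p ^ m = e.permCongr (p ^ m) :=
  (map_zpow e.permCongrHom p m).symm

/-- The chain complexes `C(X × ℝ) ⟶ C(X × ℝ) ⟶ C(X × S¹)`. -/
abbrev circleShortComplex : ShortComplex (ChainComplex (ModuleCat.{0} ℤ) ℕ) :=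
  orbitShortComplex (TopCat.toSSet.map (TopCat.ofHom (shift X)))
    (TopCat.toSSet.map (TopCat.ofHom (unroll X)))
    (by rw [← Functor.map_comp, ← TopCat.ofHom_comp, unroll_comp_shift])

/-- Simplices are contractible, so they lift to X × ℝ; they are connected, so two lifts differ by
one power of the shift; no nonzero power fixes a simplex. -/
theorem circleShortComplex_shortExact : (circleShortComplex X).ShortExact := by
  refine orbitShortComplex_shortExact _ _ _
    (fun n => (TopCat.toSSetObjEquiv (TopCat.of (X × ℝ)) (.op (.mk n))).symm.permCongr
      (shiftPerm X (stdSimplex ℝ (Fin (n + 1))))) (fun n s => ?_) (fun n s m h => ?_)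
    (fun n => ?_) (fun n s s' => ?_)
  · apply (TopCat.toSSetObjEquiv (TopCat.of (X × ℝ)) (.op (.mk n))).injective
    simp only [Equiv.permCongr_apply, Equiv.apply_symm_apply]
    rfl
  · apply shiftPerm_free X _ (TopCat.toSSetObjEquiv (TopCat.of (X × ℝ)) (.op (.mk n)) s) m
    rw [permCongr_zpow, Equiv.permCongr_apply] at h
    simpa using congrArg (TopCat.toSSetObjEquiv (TopCat.of (X × ℝ)) (.op (.mk n))) h
  · intro b
    obtain ⟨s, hs⟩ := unroll_comp_surjective X _
      (TopCat.toSSetObjEquiv (TopCat.of (X × Circle)) (.op (.mk n)) b)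
    refine ⟨(TopCat.toSSetObjEquiv (TopCat.of (X × ℝ)) (.op (.mk n))).symm s, ?_⟩
    apply (TopCat.toSSetObjEquiv (TopCat.of (X × Circle)) (.op (.mk n))).injective
    exact hs
  · rw [← (TopCat.toSSetObjEquiv (TopCat.of (X × Circle)) (.op (.mk n))).injective.eq_iff]
    refine (unroll_comp_eq_iff X _ (TopCat.toSSetObjEquiv (TopCat.of (X × ℝ)) (.op (.mk n)) s)
      (TopCat.toSSetObjEquiv (TopCat.of (X × ℝ)) (.op (.mk n)) s')).trans ?_
    refine exists_congr fun m => ?_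
    rw [permCongr_zpow, Equiv.permCongr_apply, Equiv.eq_symm_apply, Equiv.symm_symm]

/-- The translation `(x, w) ↦ (x, w + v)` of `X × ℝ`. -/
def translate (v : ℝ) : C(X × ℝ, X × ℝ) := ⟨fun q => (q.1, q.2 + v), by fun_prop⟩

theorem translate_homotopic_id (v : ℝ) : (translate X v).Homotopic (ContinuousMap.id _) :=
  ⟨{ toFun := fun q => (q.2.1, q.2.2 + (1 - q.1) * v)
     continuous_toFun := by fun_prop
     map_zero_left := fun p => by simp [translate]
     map_one_left := fun p => by simp }⟩

/-- The shift slides back to the identity along ℝ. This vanishing is what cuts the long exact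
sequence into short ones. -/
theorem homologyMap_circleShortComplex_f (j : ℕ) :
    HomologicalComplex.homologyMap (circleShortComplex X).f j = 0 := by
  refine (HomologicalComplex.homologyMap_sub _ _ j).trans
    (sub_eq_zero.2 (Eq.trans ?_ (HomologicalComplex.homologyMap_id _ j).symm))
  ext1
  exact (homologyMap_eq_of_homotopic j (translate_homotopic_id X (2 * π))).trans (homologyMap_id j)

theorem homologyMap_unroll_injective (j : ℕ) : Function.Injective (homologyMap j (unroll X)) := by
  have := (ShortComplex.exact_iff_mono _ (homologyMap_circleShortComplex_f X j)).1
    ((circleShortComplex_shortExact X).homology_exact₂ j)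
  exact (ModuleCat.mono_iff_injective _).1 this

theorem homologyMap_unroll_surjective_zero : Function.Surjective (homologyMap 0 (unroll X)) := by
  have := (circleShortComplex_shortExact X).epi_g
  have := HomologicalComplex.epi_homologyMap_of_epi_of_not_rel (circleShortComplex X).g 0 (by simp)
  exact (ModuleCat.epi_iff_surjective _).1 this

/-- The connecting map `H_{j+1}(X × S¹) → H_j(X × ℝ)`. -/
def circleBoundary (j : ℕ) : homology (j + 1) (X × Circle) →ₗ[ℤ] homology j (X × ℝ) :=
  ((circleShortComplex_shortExact X).δ (j + 1) j rfl).hom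

theorem circleBoundary_surjective (j : ℕ) : Function.Surjective (circleBoundary X j) := by
  have := (ShortComplex.exact_iff_epi _ (homologyMap_circleShortComplex_f X j)).1
    ((circleShortComplex_shortExact X).homology_exact₁ (j + 1) j rfl)
  exact (ModuleCat.epi_iff_surjective _).1 this

theorem exact_unroll_circleBoundary (j : ℕ) :
    Function.Exact (homologyMap (j + 1) (unroll X)) (circleBoundary X j) :=
  (ShortComplex.ShortExact.moduleCat_exact_iff_function_exact _).1
    ((circleShortComplex_shortExact X).homology_exact₃ (j + 1) j rfl)

/-- The map `(x, v) ↦ (p x, d v)` of `X × ℝ`. -/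
def mapMul {X : Type} [TopologicalSpace X] (p : C(X, X)) (d : ℕ) : C(X × ℝ, X × ℝ) :=
  ⟨fun q => (p q.1, d * q.2), by fun_prop⟩

/-- The map `(x, z) ↦ (p x, z ^ d)` of `X × S¹`. -/
def mapPow {X : Type} [TopologicalSpace X] (p : C(X, X)) (d : ℕ) : C(X × Circle, X × Circle) :=
  ⟨fun q => (p q.1, q.2 ^ d), by fun_prop⟩

variable {X} in
theorem mapPow_comp_unroll (p : C(X, X)) (d : ℕ) :
    (mapPow p d).comp (unroll X) = (unroll X).comp (mapMul p d) := by
  ext q <;> simp [mapPow, mapMul, unroll, Circle.exp_natCast_mul]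

variable {X} in
/-- The chain map `(1 + τ + ⋯ + τ ^ (d - 1)) P`, where `τ` is the shift of `X × ℝ` and `P` is
`(x, v) ↦ (p x, d v)`. -/
def normMap (p : C(X, X)) (d : ℕ) : singularChains (X × ℝ) ⟶ singularChains (X × ℝ) :=
  ∑ i ∈ Finset.range d, singularChainsMap ((translate X (i * (2 * π))).comp (mapMul p d))

variable {X} in
-- With P the map `mapMul p d`, one has P τ = τ^d P, and (τ − 1)(1 + ⋯ + τ^(d−1)) telescopes to τ^d
-- − 1.
theorem normMap_comp (p : C(X, X)) (d : ℕ) :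
    normMap p d ≫ (singularChainsMap (shift X) - 𝟙 _) =
      (singularChainsMap (shift X) - 𝟙 _) ≫ singularChainsMap (mapMul p d) := by
  have h1 : ∀ i : ℕ, (shift X).comp ((translate X (i * (2 * π))).comp (mapMul p d)) =
      (translate X ((i + 1 : ℕ) * (2 * π))).comp (mapMul p d) := fun i => by
    ext q <;> simp [shift, translate, mapMul]; ring
  have h2 : (mapMul p d).comp (shift X) = (translate X (d * (2 * π))).comp (mapMul p d) := by
    ext q <;> simp [shift, translate, mapMul]; ring
  have h3 : (translate X ((0 : ℕ) * (2 * π))).comp (mapMul p d) = mapMul p d := by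
    ext q <;> simp [translate, mapMul]
  rw [normMap, Preadditive.sum_comp]
  simp only [Preadditive.comp_sub, Category.comp_id, ← singularChainsMap_comp, h1]
  rw [Finset.sum_range_sub (fun i : ℕ =>
      singularChainsMap ((translate X (i * (2 * π))).comp (mapMul p d))),
    Preadditive.sub_comp, Category.id_comp, ← singularChainsMap_comp, h2, h3]

variable {X} in
-- Each of the d summands is P followed by a translation, hence homotopic to P.
theorem homologyMap_normMap (p : C(X, X)) (d j : ℕ) :
    (HomologicalComplex.homologyMap (normMap p d) j).hom = d • homologyMap j (mapMul p d) := by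
  have hsum : HomologicalComplex.homologyMap (normMap p d) j =
      ∑ i ∈ Finset.range d, HomologicalComplex.homologyMap
        (singularChainsMap ((translate X (i * (2 * π))).comp (mapMul p d))) j :=
    Functor.map_sum (HomologicalComplex.homologyFunctor (ModuleCat.{0} ℤ) (ComplexShape.down ℕ) j)
      _ _
  have : ∀ i ∈ Finset.range d, HomologicalComplex.homologyMap
      (singularChainsMap ((translate X (i * (2 * π))).comp (mapMul p d))) j =
      HomologicalComplex.homologyMap (singularChainsMap (mapMul p d)) j := fun i _ => by
    ext1
    exact homologyMap_eq_of_homotopic j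
      ((translate_homotopic_id X _).comp (ContinuousMap.Homotopic.refl (mapMul p d)))
  rw [hsum, Finset.sum_congr rfl this, Finset.sum_const, Finset.card_range]
  rfl

variable {X} in
/-- The endomorphism of `circleShortComplex X` covering `(x, z) ↦ (p x, z ^ d)`. -/
def circleShortComplexMap (p : C(X, X)) (d : ℕ) : circleShortComplex X ⟶ circleShortComplex X where
  τ₁ := normMap p d
  τ₂ := singularChainsMap (mapMul p d)
  τ₃ := singularChainsMap (mapPow p d)
  comm₁₂ := normMap_comp p d
  comm₂₃ := (singularChainsMap_comp _ _).symm.trans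
    ((congrArg singularChainsMap (mapPow_comp_unroll p d).symm).trans (singularChainsMap_comp _ _))

variable {X} in
theorem circleBoundary_mapPow (p : C(X, X)) (d j : ℕ) (c : homology (j + 1) (X × Circle)) :
    circleBoundary X j (homologyMap (j + 1) (mapPow p d) c) =
      d • homologyMap j (mapMul p d) (circleBoundary X j c) := by
  have := HomologicalComplex.HomologySequence.δ_naturality (circleShortComplexMap p d)
    (circleShortComplex_shortExact X) (circleShortComplex_shortExact X) (j + 1) j rfl
  have := congrArg ModuleCat.Hom.hom this
  have h := congr($this c)
  refine h.symm.trans ?_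
  exact congr($(homologyMap_normMap p d j) (circleBoundary X j c))

end CircleBundle

/-! ### Power maps of the torus are injective on homology -/

/-- The self map `p` of `X` is injective on the homology of `X`, which is torsion free with Betti
numbers `k.choose j`. -/
structure IsTorusLike {X : Type} [TopologicalSpace X] (p : C(X, X)) (k : ℕ) : Prop where
  torsionFree : ∀ (j d : ℕ), d ≠ 0 → ∀ c : homology j X, d • c = 0 → c = 0
  injective : ∀ j, Function.Injective (homologyMap j p)
  rank_eq : ∀ j, Module.rank ℤ (homology j X) = k.choose j

namespace IsTorusLike

variable {X Y : Type} [TopologicalSpace X] [TopologicalSpace Y]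

theorem of_homotopyEquiv {p : C(X, X)} {q : C(Y, Y)} {k : ℕ} (h : IsTorusLike p k)
    (e : ContinuousMap.HomotopyEquiv Y X) (he : e.toFun.comp q = p.comp e.toFun) :
    IsTorusLike q k where
  torsionFree j d hd c hc := by
    apply (homologyEquiv j e).injective
    rw [map_zero]
    apply h.torsionFree j d hd
    rw [← map_nsmul, hc, map_zero]
  injective j := by
    have h1 : homologyMap j e.toFun ∘ₗ homologyMap j q =
        homologyMap j p ∘ₗ homologyMap j e.toFun := by
      rw [← homologyMap_comp, he, homologyMap_comp]
    have h2 : Function.Injective (homologyMap j e.toFun ∘ₗ homologyMap j q) := by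
      rw [h1]
      exact (h.injective j).comp (homologyEquiv j e).injective
    exact Function.Injective.of_comp (f := homologyMap j e.toFun) h2
  rank_eq j := by rw [(homologyEquiv j e).rank_eq, h.rank_eq]

/-- The projection `X × ℝ → X` is a homotopy equivalence. -/
def fstEquiv (X : Type) [TopologicalSpace X] : ContinuousMap.HomotopyEquiv (X × ℝ) X where
  toFun := ContinuousMap.fst
  invFun := (ContinuousMap.id X).prodMk (ContinuousMap.const X 0)
  left_inv := ⟨{
    toFun := fun q => (q.2.1, q.1 * q.2.2)
    continuous_toFun := by fun_prop
    map_zero_left := fun p => by simp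
    map_one_left := fun p => by simp }⟩
  right_inv := ⟨ContinuousMap.Homotopy.refl _⟩

theorem prod_real {p : C(X, X)} {k : ℕ} (h : IsTorusLike p k) (d : ℕ) :
    IsTorusLike (mapMul p d) k :=
  h.of_homotopyEquiv (fstEquiv X) rfl

/-- A class killed by the boundary comes from X × ℝ, where the induction hypothesis applies; in
degree 0 every class does. Ranks add by Pascal's rule. -/
theorem prod_circle {p : C(X, X)} {k : ℕ} (h : IsTorusLike p k) {d : ℕ} (hd : d ≠ 0) :
    IsTorusLike (mapPow p d) (k + 1) := by
  have hR := h.prod_real d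
  have hnat : ∀ j (b : homology j (X × ℝ)), homologyMap j (mapPow p d) (homologyMap j (unroll X) b)
      = homologyMap j (unroll X) (homologyMap j (mapMul p d) b) := fun j b => by
    rw [← homologyMap_comp_apply, mapPow_comp_unroll, homologyMap_comp_apply]
  refine ⟨fun j m hm c hc => ?_, fun j => ?_, fun j => ?_⟩
  · have key : ∀ b, c = homologyMap j (unroll X) b → c = 0 := by
      rintro b rfl
      rw [← map_nsmul] at hc
      rw [hR.torsionFree j m hm b (homologyMap_unroll_injective X j (hc.trans (map_zero _).symm)),
        map_zero]
    cases j with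
    | zero =>
      obtain ⟨b, hb⟩ := homologyMap_unroll_surjective_zero X c
      exact key b hb.symm
    | succ j =>
      have : circleBoundary X j c = 0 := hR.torsionFree j m hm _ (by rw [← map_nsmul, hc, map_zero])
      obtain ⟨b, hb⟩ := (exact_unroll_circleBoundary X j c).1 this
      exact key b hb.symm
  · rw [injective_iff_map_eq_zero]
    intro c hc
    have key : ∀ b, c = homologyMap j (unroll X) b → c = 0 := by
      rintro b rfl
      rw [hnat] at hc
      have := homologyMap_unroll_injective X j (hc.trans (map_zero _).symm)
      rw [hR.injective j (this.trans (map_zero _).symm), map_zero]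
    cases j with
    | zero =>
      obtain ⟨b, hb⟩ := homologyMap_unroll_surjective_zero X c
      exact key b hb.symm
    | succ j =>
      -- The boundary of c is killed by d times an injective map; torsion-freeness cancels d.
      have h1 := circleBoundary_mapPow p d j c
      rw [hc, map_zero] at h1
      have h2 := hR.injective j ((hR.torsionFree j d hd _ h1.symm).trans (map_zero _).symm)
      obtain ⟨b, hb⟩ := (exact_unroll_circleBoundary X j c).1 h2
      exact key b hb.symm
  · cases j with
    | zero =>
      rw [← (LinearEquiv.ofBijective (homologyMap 0 (unroll X))
        ⟨homologyMap_unroll_injective X 0, homologyMap_unroll_surjective_zero X⟩).rank_eq,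
        hR.rank_eq]
      simp
    | succ j =>
      have h1 := LinearMap.rank_range_add_rank_ker (circleBoundary X j)
      rw [LinearMap.range_eq_top.2 (circleBoundary_surjective X j), rank_top,
        (exact_unroll_circleBoundary X j).linearMap_ker_eq,
        rank_range_of_injective _ (homologyMap_unroll_injective X (j + 1)),
        hR.rank_eq, hR.rank_eq] at h1
      rw [← h1, Nat.choose_succ_succ, Nat.cast_add]

end IsTorusLike

/-- The power map `t ↦ t ^ d` of the torus. -/
def torusPow (k d : ℕ) : C(Torus k, Torus k) := ⟨fun t => t ^ d, by fun_prop⟩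

/-- T⁰ is one point, hence totally disconnected: its homology is free on its points in degree 0 and
zero above. -/
theorem isTorusLike_torusPow_zero (d : ℕ) : IsTorusLike (torusPow 0 d) 0 := by
  have hid : torusPow 0 d = ContinuousMap.id _ := ContinuousMap.ext fun t => Subsingleton.elim _ _
  let e₀ : homology 0 (Torus 0) ≃ₗ[ℤ] (Torus 0 →₀ ℤ) :=
    ((AlgebraicTopology.singularHomologyFunctorZeroOfTotallyDisconnectedSpace (ModuleCat.{0} ℤ)
      (ModuleCat.of ℤ ℤ) (TopCat.of (Torus 0))) ≪≫
      (coproductIsCoproduct _).coconePointUniqueUpToIso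
        (ModuleCat.finsuppCoconeIsColimit ℤ ℤ (Torus 0))).toLinearEquiv
  have hpos : ∀ j, Subsingleton (homology (j + 1) (Torus 0)) := fun j =>
    ModuleCat.subsingleton_of_isZero
      (AlgebraicTopology.isZero_singularHomologyFunctor_of_totallyDisconnectedSpace
        (ModuleCat.{0} ℤ) (j + 1) (ModuleCat.of ℤ ℤ) (TopCat.of (Torus 0)) (by simp))
  refine ⟨fun j m hm c hc => ?_, fun j => ?_, fun j => ?_⟩
  · cases j with
    | zero =>
      apply e₀.injective
      have : m • e₀ c = 0 := by rw [← map_nsmul, hc, map_zero]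
      rw [map_zero]
      exact (smul_eq_zero.1 this).resolve_left hm
    | succ j => exact Subsingleton.elim _ _
  · rw [hid, homologyMap_id]
    exact Function.injective_id
  · cases j with
    | zero => rw [e₀.rank_eq]; simp
    | succ j => simp

theorem isTorusLike_torusPow (k : ℕ) {d : ℕ} (hd : d ≠ 0) : IsTorusLike (torusPow k d) k := by
  induction k with
  | zero => exact isTorusLike_torusPow_zero d
  | succ k ih =>
    let e : Torus (k + 1) ≃ₜ Torus k × Circle :=
      { toFun := fun t => (Fin.tail t, t 0)
        invFun := fun q => Fin.cons q.2 q.1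
        left_inv := fun t => Fin.cons_self_tail t
        right_inv := fun q => by simp
        continuous_toFun := by unfold Fin.tail; fun_prop
        continuous_invFun := by fun_prop }
    exact (ih.prod_circle hd).of_homotopyEquiv e.toHomotopyEquiv rfl

/-! ### Winding numbers of loops in the torus -/

section Winding

/-- The exponential homomorphism `ℝ^k → T^k`. -/
def torusExp (k : ℕ) : Multiplicative (Fin k → ℝ) →* Torus k where
  toFun v := fun i => Circle.exp (v.toAdd i)
  map_one' := by ext1 i; simp
  map_mul' v w := by ext1 i; simp [Circle.exp_add]

/-- The period lattice `2πℤ^k` of the torus, written multiplicatively. -/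
abbrev periods (k : ℕ) : Subgroup (Multiplicative (Fin k → ℝ)) := (torusExp k).ker

/-- Translating the lift from 0 by a period e gives the lift from e. -/
theorem monodromy_exp_add (b : Path.Homotopic.Quotient (1 : Circle) 1)
    (e : Circle.exp ⁻¹' {(1 : Circle)}) :
    (Circle.isCoveringMap_exp.monodromy b e : ℝ) =
      e + Circle.isCoveringMap_exp.monodromy b ⟨0, Circle.exp_zero⟩ := by
  induction b using Path.Homotopic.Quotient.ind with | mk γ =>
  have h0 : γ 0 = Circle.exp 0 := by simp
  have he : γ 0 = Circle.exp e := γ.source.trans e.2.symm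
  let Γ := Circle.isCoveringMap_exp.liftPath (γ : C(unitInterval, Circle)) 0 h0
  have hΓ : ∀ t, Circle.exp (Γ t) = γ t :=
    fun t => congrFun (Circle.isCoveringMap_exp.liftPath_lifts _ _ h0) t
  have hΓ0 : Γ 0 = 0 := Circle.isCoveringMap_exp.liftPath_zero _ _ h0
  have hadd := (Circle.isCoveringMap_exp.eq_liftPath_iff' (γ := (γ : C(unitInterval, Circle)))
    (e := (e : ℝ)) he (Γ := ContinuousMap.const _ (e : ℝ) + Γ)).2
    ⟨funext fun t => by
      have : Circle.exp (e : ℝ) = 1 := e.2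
      simp [Circle.exp_add, hΓ, this], by simp [hΓ0]⟩
  exact congr($hadd.symm 1)

/-- The homomorphism `π₁(T^k) → 2πℤ^k` given by the end point of the lift of a loop to `ℝ^k`. -/
def winding (k : ℕ) : FundamentalGroup (Torus k) 1 →* periods k where
  toFun a := ⟨Multiplicative.ofAdd fun i => Circle.isCoveringMap_exp.monodromy
      (Path.Homotopic.Quotient.map (X := Torus k) a ⟨fun t => t i, continuous_apply i⟩)
      ⟨0, Circle.exp_zero⟩,
    MonoidHom.mem_ker.2 (funext fun i => (Circle.isCoveringMap_exp.monodromy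
      (Path.Homotopic.Quotient.map (X := Torus k) a ⟨fun t => t i, continuous_apply i⟩)
      ⟨0, Circle.exp_zero⟩).2)⟩
  map_one' := by
    ext i
    exact congrArg Subtype.val (congrFun (Circle.isCoveringMap_exp.monodromy_refl (x := 1))
      ⟨0, Circle.exp_zero⟩)
  map_mul' a b := by
    apply Subtype.ext
    apply Multiplicative.toAdd.injective
    funext i
    let ea := Path.Homotopic.Quotient.map (X := Torus k) a ⟨fun t => t i, continuous_apply i⟩
    let eb := Path.Homotopic.Quotient.map (X := Torus k) b ⟨fun t => t i, continuous_apply i⟩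
    have h1 : Path.Homotopic.Quotient.map (X := Torus k) (a * b)
        ⟨fun t => t i, continuous_apply i⟩ = eb.trans ea := by
      rw [FundamentalGroup.mul_def]
      induction a using Path.Homotopic.Quotient.ind with | mk a =>
      induction b using Path.Homotopic.Quotient.ind with | mk b =>
      exact congrArg Path.Homotopic.Quotient.mk (Path.map_trans _ _ _)
    have h2 : (Circle.isCoveringMap_exp.monodromy (eb.trans ea) ⟨0, Circle.exp_zero⟩ : ℝ) =
        Circle.isCoveringMap_exp.monodromy ea ⟨0, Circle.exp_zero⟩ +
        Circle.isCoveringMap_exp.monodromy eb ⟨0, Circle.exp_zero⟩ := by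
      rw [Circle.isCoveringMap_exp.monodromy_trans_apply, add_comm]
      exact monodromy_exp_add ea _
    exact (congrArg (fun q => (Circle.isCoveringMap_exp.monodromy q ⟨0, Circle.exp_zero⟩ : ℝ))
      h1).trans h2

/-- The loop in the torus which is the image of the segment from `0` to a period. -/
def periodLoop {k : ℕ} (w : periods k) : Path (1 : Torus k) 1 where
  toFun s := fun i => Circle.exp (s * (w : Multiplicative (Fin k → ℝ)).toAdd i)
  continuous_toFun := by fun_prop
  source' := by ext1 i; simp
  target' := by
    have := MonoidHom.mem_ker.1 w.2
    rw [← this]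
    ext1 i
    simp [torusExp]

/-- The straight segment is itself the lift of the loop. Every period is thus a winding, which is
all the later argument needs to know about π₁(T^k). -/
theorem winding_periodLoop {k : ℕ} (w : periods k) :
    winding k (Path.Homotopic.Quotient.mk (periodLoop w)) = w := by
  apply Subtype.ext
  apply Multiplicative.toAdd.injective
  funext i
  have := (Circle.isCoveringMap_exp.eq_liftPath_iff'
    (γ := (((periodLoop w).map (continuous_apply i) : Path _ _) : C(unitInterval, Circle)))
    (e := (0 : ℝ)) (by simp)
    (Γ := ⟨fun s => (s : ℝ) * (w : Multiplicative (Fin k → ℝ)).toAdd i, by fun_prop⟩)).2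
    ⟨rfl, by simp⟩
  refine (congr($this 1)).symm.trans ?_
  simp

end Winding

/-! ### From the splitting to a homomorphism on π₁(M) -/

section Transfer

variable {k : ℕ} {M : Type} [TopologicalSpace M] [MulAction (Torus k) M]
  [ContinuousSMul (Torus k) M]

/-- A splitting over a subgroup of `Q` gives a retraction of its preimage onto `π₁(T^k)`. -/
theorem exists_retraction {x : M} (hinj : IsInjectiveAction k x) (Q' : Subgroup (Q k x))
    (s : Q' →* Q'.comap (QuotientGroup.mk' (evPi k x).range))
    (hs : ∀ q : Q', ((s q : FundamentalGroup M x) : Q k x) = q) :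
    ∃ r : Q'.comap (QuotientGroup.mk' (evPi k x).range) →* FundamentalGroup (Torus k) 1,
      ∀ (z : FundamentalGroup (Torus k) 1) (hz : evPi k x z ∈ Q'.comap (QuotientGroup.mk' _)),
        r ⟨evPi k x z, hz⟩ = z := by
  let H := Q'.comap (QuotientGroup.mk' (evPi k x).range)
  let t : H →* FundamentalGroup M x :=
    H.subtype.comp (s.comp ((QuotientGroup.mk' (evPi k x).range).subgroupComap Q'))
  have ht : ∀ g : H, ((t g : FundamentalGroup M x) : Q k x) = (g : FundamentalGroup M x) :=
    fun g => hs _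
  have hmem : ∀ g : H, (g : FundamentalGroup M x) * (t g)⁻¹ ∈ (evPi k x).range := fun g => by
    rw [← QuotientGroup.eq_one_iff, QuotientGroup.mk_mul, QuotientGroup.mk_inv, ht,
      mul_inv_cancel]
  have hcomm : ∀ (c d : FundamentalGroup M x), c ∈ (evPi k x).range → c * d = d * c := by
    rintro _ d ⟨z, rfl⟩
    exact evPi_commute k x z d
  -- Dividing g by its image under the section leaves the central part; centrality makes this
  -- multiplicative.
  let r₀ : H →* (evPi k x).range :=
    MonoidHom.mk' (fun g => ⟨(g : FundamentalGroup M x) * (t g)⁻¹, hmem g⟩) fun g g' => by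
      apply Subtype.ext
      have := hcomm _ (t g)⁻¹ (hmem g')
      simp only [Subgroup.coe_mul, map_mul, mul_inv_rev]
      rw [mul_assoc (g : FundamentalGroup M x), ← mul_assoc (g' : FundamentalGroup M x), this]
      simp only [mul_assoc]
  refine ⟨(MonoidHom.ofInjective hinj).symm.toMonoidHom.comp r₀, fun z hz => ?_⟩
  change (MonoidHom.ofInjective hinj).symm (r₀ ⟨evPi k x z, hz⟩) = z
  rw [MulEquiv.symm_apply_eq]
  apply Subtype.ext
  have h1 : t ⟨evPi k x z, hz⟩ = 1 := by
    have : (QuotientGroup.mk' (evPi k x).range).subgroupComap Q' ⟨evPi k x z, hz⟩ = 1 :=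
      Subtype.ext ((QuotientGroup.eq_one_iff _).2 ⟨z, rfl⟩)
    simp only [t, MonoidHom.comp_apply, this, map_one]
  change evPi k x z * (t ⟨evPi k x z, hz⟩)⁻¹ = evPi k x z
  rw [h1, inv_one, mul_one]

/-- The transfer extends a nonzero multiple of the identity of `π₁(T^k)` to `π₁(M)`. -/
theorem exists_periods_hom {x : M} (h : IsInjectiveSplitting k x) :
    ∃ d : ℕ, d ≠ 0 ∧ ∃ φ : FundamentalGroup M x →* periods k,
      ∀ z, φ (evPi k x z) = winding k z ^ d := by
  obtain ⟨hinj, Q', -, hfin, s, hs⟩ := h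
  obtain ⟨r, hr⟩ := exists_retraction hinj Q' s hs
  let H := Q'.comap (QuotientGroup.mk' (evPi k x).range)
  have hz : ∀ z, evPi k x z ∈ H := fun z => by
    have : (QuotientGroup.mk' (evPi k x).range) (evPi k x z) = 1 :=
      (QuotientGroup.eq_one_iff _).2 ⟨z, rfl⟩
    rw [Subgroup.mem_comap, this]
    exact one_mem _
  have : H.FiniteIndex :=
    ⟨by rw [Subgroup.index_comap_of_surjective _ (QuotientGroup.mk'_surjective _)]
        exact hfin.index_ne_zero⟩
  -- The multiplier d is the index of H. On a central element the transfer is evaluation at its d-th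
  -- power, because conjugation does nothing.
  refine ⟨H.index, this.index_ne_zero, ((winding k).comp r).transfer, fun z => ?_⟩
  have key := MonoidHom.transfer_eq_pow ((winding k).comp r) (evPi k x z) (fun m g _ => by
    rw [← map_pow, mul_assoc, evPi_commute, inv_mul_cancel_left])
  rw [key]
  simp only [← map_pow, MonoidHom.comp_apply]
  rw [hr]

end Transfer

/-! ### Path cocycles and their primitives -/

/-- An additive function of homotopy classes of paths. -/
structure PathCocycle (X V : Type*) [TopologicalSpace X] [AddCommGroup V] where
  /-- The value on a path. -/
  toFun : ∀ {x y : X}, Path x y → V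
  map_trans : ∀ {x y z : X} (p : Path x y) (q : Path y z), toFun (p.trans q) = toFun p + toFun q
  map_homotopic : ∀ {x y : X} {p q : Path x y}, p.Homotopic q → toFun p = toFun q

namespace PathCocycle

variable {X V : Type*} [TopologicalSpace X] [AddCommGroup V] (c : PathCocycle X V)

theorem map_congr {x y x' y' : X} (p : Path x y) (q : Path x' y') (h : ∀ t, p t = q t) :
    c.toFun p = c.toFun q := by
  obtain rfl : x = x' := by simpa using h 0
  obtain rfl : y = y' := by simpa using h 1
  exact congrArg _ (Path.ext (funext h))

theorem homotopic_of_isSimplyConnected {U : Set X} (hU : IsSimplyConnected U) {x y : X}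
    (p q : Path x y) (hp : ∀ t, p t ∈ U) (hq : ∀ t, q t ∈ U) : p.Homotopic q := by
  have := hU.simplyConnectedSpace
  let x' : U := ⟨x, by simpa using hp 0⟩
  let y' : U := ⟨y, by simpa using hp 1⟩
  let p' : Path x' y' := ⟨⟨fun t => ⟨p t, hp t⟩, by fun_prop⟩, by simp [x'], by simp [y']⟩
  let q' : Path x' y' := ⟨⟨fun t => ⟨q t, hq t⟩, by fun_prop⟩, by simp [x'], by simp [y']⟩
  exact (SimplyConnectedSpace.paths_homotopic p' q').map ⟨Subtype.val, continuous_subtype_val⟩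

/-- On a compact Hausdorff space covered by simply connected open sets, a path cocycle is locally
the difference of a continuous function and a fixed function. -/
theorem exists_primitive [CompactSpace X] [T2Space X] [Module ℝ V] [TopologicalSpace V]
    [IsTopologicalAddGroup V] [ContinuousSMul ℝ V]
    (hX : ∀ x : X, ∃ U : Set X, IsOpen U ∧ x ∈ U ∧ IsSimplyConnected U) :
    ∃ F : X → V, ∀ x₁, ∃ W ∈ 𝓝 x₁, ∃ h : X → V, Continuous h ∧
      ∀ (x : X) (w : Path x₁ x), (∀ t, w t ∈ W) → F x + c.toFun w = h x := by
  classical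
  choose U hUo hUm hUs using hX
  obtain ⟨t, ht⟩ := CompactSpace.elim_nhds_subcover U fun x => (hUo x).mem_nhds (hUm x)
  obtain ⟨ρ, hρ⟩ := PartitionOfUnity.exists_isSubordinate (isClosed_univ (X := X))
    (fun i : t => U i) (fun i => hUo i) (fun x _ => by
      have : x ∈ ⋃ i ∈ t, U i := by rw [ht]; trivial
      simpa using this)
  have hρU : ∀ (i : t) x, x ∉ U i → ρ i x = 0 := fun i x hx => by
    by_contra h
    exact hx (hρ i (subset_tsupport _ h))
  have hsum : ∀ x, ∑ i, ρ i x = 1 := fun x => by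
    rw [← finsum_eq_sum_of_fintype]
    exact ρ.sum_eq_one (Set.mem_univ x)
  -- The local primitive on U i: the cocycle on a path inside U i from x to the centre. Simple
  -- connectedness makes the choice of path irrelevant.
  let q : ∀ (i : t) (x : X), x ∈ U i → V := fun i x hx =>
    c.toFun ((hUs i).isPathConnected.joinedIn x hx i (hUm i)).somePath
  refine ⟨fun x => ∑ i : t, ρ i x • (if hx : x ∈ U i then q i x hx else 0), fun x₁ => ?_⟩
  -- On this neighbourhood only indices with x₁ ∈ U i contribute. The function h freezes their local
  -- primitives at x₁, so it varies only through the continuous weights.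
  refine ⟨⋂ i : t, if x₁ ∈ U i then U i else (tsupport (ρ i))ᶜ, ?_,
    fun x => ∑ i : t, ρ i x • (if hx : x₁ ∈ U i then q i x₁ hx else 0), ?_, ?_⟩
  · refine (Filter.iInter_mem (s := fun i : t => if x₁ ∈ U i then U i else (tsupport (ρ i))ᶜ)).2
      fun i => ?_
    split_ifs with hi
    · exact (hUo i).mem_nhds hi
    · exact (isClosed_tsupport _).isOpen_compl.mem_nhds fun h => hi (hρ i h)
  · exact continuous_finsetSum _ fun i _ => (ρ i).continuous.smul continuous_const
  · intro x w hw
    have hw' : ∀ (i : t) s, w s ∈ if x₁ ∈ U i then U i else (tsupport (ρ i))ᶜ :=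
      fun i s => Set.mem_iInter.1 (hw s) i
    have : c.toFun w = ∑ i : t, ρ i x • c.toFun w := by
      rw [← Finset.sum_smul, hsum, one_smul]
    rw [this, ← Finset.sum_add_distrib]
    refine Finset.sum_congr rfl fun i _ => ?_
    rw [← smul_add]
    by_cases hi : x₁ ∈ U i
    · have hwU : ∀ s, w s ∈ U i := fun s => by simpa [hi] using hw' i s
      have hx : x ∈ U i := by simpa using hwU 1
      rw [dif_pos hx, dif_pos hi, add_comm, ← c.map_trans]
      congr 1
      refine c.map_homotopic (homotopic_of_isSimplyConnected (hUs i) _ _ (fun s => ?_) fun s =>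
        JoinedIn.somePath_mem _ s)
      rw [← Set.mem_preimage]
      have := Path.trans_range w
        ((hUs i).isPathConnected.joinedIn x hx i (hUm i)).somePath
      have hs := Set.mem_range_self (f := (w.trans
        ((hUs i).isPathConnected.joinedIn x hx i (hUm i)).somePath)) s
      rw [this] at hs
      rcases hs with ⟨s', hs'⟩ | ⟨s', hs'⟩
      · rw [Set.mem_preimage, ← hs']; exact hwU s'
      · rw [Set.mem_preimage, ← hs']; exact JoinedIn.somePath_mem _ s'
    · have hx : x ∉ tsupport (ρ i) := by simpa [hi] using hw' i 1
      rw [image_eq_zero_of_notMem_tsupport hx, zero_smul, zero_smul]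

end PathCocycle

/-! ### The path cocycle of a homomorphism from π₁ -/

section Holonomy

variable {X : Type*} [TopologicalSpace X] [PathConnectedSpace X] {x₀ : X} {k : ℕ}

/-- The class of the loop at `x₀` formed by a path and chosen paths from `x₀` to its ends. -/
def closeUp {x y : X} (p : Path x y) : FundamentalGroup X x₀ :=
  Path.Homotopic.Quotient.mk (((PathConnectedSpace.somePath x₀ x).trans p).trans
    (PathConnectedSpace.somePath x₀ y).symm)

theorem closeUp_trans {x y z : X} (p : Path x y) (q : Path y z) :
    closeUp (x₀ := x₀) (p.trans q) = closeUp q * closeUp p := by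
  rw [FundamentalGroup.mul_def]
  simp only [closeUp, Path.Homotopic.Quotient.mk_trans, Path.Homotopic.Quotient.mk_symm,
    Path.Homotopic.Quotient.trans_assoc]
  rw [← Path.Homotopic.Quotient.trans_assoc (Path.Homotopic.Quotient.symm _)]
  simp

/-- The path cocycle defined by a homomorphism from the fundamental group to the periods. -/
def holonomy (φ : FundamentalGroup X x₀ →* periods k) : PathCocycle X (Fin k → ℝ) where
  toFun p := (φ (closeUp p) : Multiplicative (Fin k → ℝ)).toAdd
  map_trans p q := by
    rw [closeUp_trans, map_mul, Subgroup.coe_mul, toAdd_mul, add_comm]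
  map_homotopic {x y p q} h := by
    have : closeUp (x₀ := x₀) p = closeUp q := by
      simp only [closeUp, Path.Homotopic.Quotient.mk_trans, Path.Homotopic.Quotient.eq.2 h]
    rw [this]

theorem torusExp_holonomy (φ : FundamentalGroup X x₀ →* periods k) {x y : X} (p : Path x y) :
    torusExp k (Multiplicative.ofAdd ((holonomy φ).toFun p)) = 1 :=
  MonoidHom.mem_ker.1 (φ (closeUp p)).2

/-- Closing up a loop at the base point only conjugates it, which is invisible in the abelian group
of periods. -/
theorem holonomy_loop (φ : FundamentalGroup X x₀ →* periods k) (p : Path x₀ x₀) :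
    (holonomy φ).toFun p =
      (φ (Path.Homotopic.Quotient.mk p) : Multiplicative (Fin k → ℝ)).toAdd := by
  let g : FundamentalGroup X x₀ := Path.Homotopic.Quotient.mk (PathConnectedSpace.somePath x₀ x₀)
  let a : FundamentalGroup X x₀ := Path.Homotopic.Quotient.mk p
  have : closeUp p = g⁻¹ * (a * g) := rfl
  change (φ (closeUp p) : Multiplicative (Fin k → ℝ)).toAdd = _
  rw [this, map_mul, map_mul, map_inv, mul_comm (φ a), inv_mul_cancel_left]

end Holonomy

/-! ### The covering ℝ^k → T^k -/

section ExpMap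

variable {k : ℕ}

/-- The exponential map `ℝ^k → T^k`. -/
def expMap (v : Fin k → ℝ) : Torus k := fun i => Circle.exp (v i)

theorem continuous_expMap : Continuous (expMap (k := k)) := by
  unfold expMap; fun_prop

theorem expMap_add (v w : Fin k → ℝ) : expMap (v + w) = expMap v * expMap w := by
  ext1 i; simp [expMap, Circle.exp_add]

theorem expMap_zero : expMap (0 : Fin k → ℝ) = 1 := by
  ext1 i; simp [expMap]

theorem expMap_nsmul (d : ℕ) (v : Fin k → ℝ) : expMap (d • v) = expMap v ^ d := by
  ext1 i; simp [expMap, Circle.exp_natCast_mul]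

theorem expMap_surjective : Function.Surjective (expMap (k := k)) := fun t =>
  ⟨fun i => (Circle.exp_surjective (t i)).choose,
    funext fun i => (Circle.exp_surjective (t i)).choose_spec⟩

theorem isQuotientMap_expMap : IsQuotientMap (expMap (k := k)) := by
  have h : IsOpenQuotientMap (Circle.exp : ℝ → Circle) :=
    ⟨Circle.exp_surjective, Circle.exp.continuous, isLocalHomeomorph_circleExp.isOpenMap⟩
  exact (IsOpenQuotientMap.piMap fun _ : Fin k => h).isQuotientMap

theorem eq_of_expMap_comp_eq {A : Type*} [TopologicalSpace A] [PreconnectedSpace A]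
    {g₁ g₂ : A → Fin k → ℝ} (h₁ : Continuous g₁) (h₂ : Continuous g₂)
    (h : ∀ a, expMap (g₁ a) = expMap (g₂ a)) (a₀ : A) (ha : g₁ a₀ = g₂ a₀) : g₁ = g₂ := by
  funext a i
  exact congrFun (Circle.isCoveringMap_exp.eq_of_comp_eq (g₁ := fun a => g₁ a i)
    (g₂ := fun a => g₂ a i) (by fun_prop) (by fun_prop)
    (funext fun a => congrFun (h a) i) a₀ (congrFun ha i)) a

end ExpMap

/-! ### The map from M to the torus -/

section TorusMap

variable {k : ℕ} {M : Type} [TopologicalSpace M] [MulAction (Torus k) M]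
  [ContinuousSMul (Torus k) M]

/-- The pullback of the orbit map at `x` to `ℝ^k`. -/
def orbitExp (k : ℕ) {M : Type} [TopologicalSpace M] [MulAction (Torus k) M]
    [ContinuousSMul (Torus k) M] (x : M) : C(Fin k → ℝ, M) :=
  ⟨fun v => expMap v • x, continuous_expMap.smul continuous_const⟩

theorem orbitExp_add_of_expMap_eq_one (x : M) {w : Fin k → ℝ} (hw : expMap w = 1)
    (v : Fin k → ℝ) : orbitExp k x (w + v) = orbitExp k x v := by
  simp [orbitExp, expMap_add, hw]

/-- The integral of a path cocycle along the orbit of `x`. -/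
def orbitIntegral (c : PathCocycle M (Fin k → ℝ)) (x : M) (v : Fin k → ℝ) : Fin k → ℝ :=
  c.toFun ((Path.segment 0 v).map (orbitExp k x).continuous)

/-- ℝ^k is simply connected, so the integral does not depend on the path. -/
theorem orbitIntegral_eq_add (c : PathCocycle M (Fin k → ℝ)) (x : M) (v w : Fin k → ℝ) :
    orbitIntegral c x w = orbitIntegral c x v +
      c.toFun ((Path.segment v w).map (orbitExp k x).continuous) := by
  rw [orbitIntegral, orbitIntegral, ← c.map_trans, ← Path.map_trans]
  exact c.map_homotopic ((SimplyConnectedSpace.paths_homotopic _ _).map _)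

theorem orbitIntegral_add (c : PathCocycle M (Fin k → ℝ)) (x : M) {w : Fin k → ℝ}
    (hw : expMap w = 1) (v : Fin k → ℝ) :
    orbitIntegral c x (w + v) = orbitIntegral c x w + orbitIntegral c x v := by
  rw [orbitIntegral_eq_add c x w]
  congr 1
  refine c.map_congr _ _ fun t => ?_
  have : Path.segment w (w + v) t = w + Path.segment 0 v t := by
    simp [AffineMap.lineMap_apply, add_comm]
  simp only [Path.map_coe, Function.comp_apply, this]
  exact orbitExp_add_of_expMap_eq_one x hw _

/-- A map to the torus which on the orbit of `x` looks like the `d`-th power map. -/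
theorem exists_torus_map [CompactSpace M] [T2Space M] [PathConnectedSpace M]
    [LocallyPathConnectedSpace M]
    (hM : ∀ x : M, ∃ U : Set M, IsOpen U ∧ x ∈ U ∧ IsSimplyConnected U)
    {x : M} (h : IsInjectiveSplitting k x) :
    ∃ d : ℕ, d ≠ 0 ∧ ∃ (f : C(M, Torus k)) (g : C(Torus k, Fin k → ℝ)),
      ∀ v, f (expMap v • x) = expMap (g (expMap v) + d • v) := by
  obtain ⟨d, hd, φ, hφ⟩ := exists_periods_hom h
  let c := holonomy φ
  have hc : ∀ {x y : M} (p : Path x y), expMap (c.toFun p) = 1 := fun p => torusExp_holonomy φ p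
  obtain ⟨F, hF⟩ := c.exists_primitive hM
  -- F may jump, but near x₁ it differs from a continuous function by values of c, which are periods
  -- and vanish under `expMap`.
  have hf : Continuous fun y => expMap (F y) := by
    rw [continuous_iff_continuousAt]
    intro x₁
    obtain ⟨W, hW, u, hu, hFu⟩ := hF x₁
    obtain ⟨W', ⟨hW', hpc⟩, hsub⟩ := (path_connected_basis x₁).mem_iff.1 hW
    refine (continuous_expMap.comp hu).continuousAt.congr ?_
    filter_upwards [hW'] with y hy
    obtain ⟨w, hw⟩ := hpc.joinedIn x₁ (mem_of_mem_nhds hW') y hy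
    have := hFu y w fun t => hsub (hw t)
    rw [Function.comp_apply, ← this, expMap_add, hc, mul_one]
  -- Adding the integral along the orbit cancels the jumps of F: G is a continuous lift of v ↦ f
  -- (expMap v • x).
  let G : (Fin k → ℝ) → (Fin k → ℝ) := fun v => F (orbitExp k x v) + orbitIntegral c x v
  have hG : Continuous G := by
    rw [continuous_iff_continuousAt]
    intro v₁
    obtain ⟨W, hW, u, hu, hFu⟩ := hF (orbitExp k x v₁)
    obtain ⟨ε, hε, hball⟩ := Metric.mem_nhds_iff.1
      ((orbitExp k x).continuous.continuousAt.preimage_mem_nhds hW)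
    have hcont : Continuous fun v => u (orbitExp k x v) + orbitIntegral c x v₁ := by fun_prop
    refine hcont.continuousAt.congr ?_
    filter_upwards [Metric.ball_mem_nhds v₁ hε] with v hv
    have := hFu _ ((Path.segment v₁ v).map (orbitExp k x).continuous) fun t => hball
      ((convex_ball v₁ ε).lineMap_mem (Metric.mem_ball_self hε) hv t.2)
    simp only [G]
    rw [← this, orbitIntegral_eq_add c x v₁ v]
    abel
  -- This is where the transfer enters: over a period the integral is φ of an orbit loop, that is, d
  -- times its winding.
  have hper : ∀ w : Fin k → ℝ, expMap w = 1 → orbitIntegral c x w = d • w := by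
    intro w hw
    let w' : periods k := ⟨Multiplicative.ofAdd w, MonoidHom.mem_ker.2 hw⟩
    have h1 : orbitIntegral c x w =
        c.toFun (((periodLoop w').map (ev k x).continuous).cast (one_smul _ x).symm
          (one_smul _ x).symm) := by
      refine c.map_congr _ _ fun t => ?_
      have : expMap (Path.segment 0 w t) = periodLoop w' t := by
        ext1 i
        simp [expMap, periodLoop, w', AffineMap.lineMap_apply]
      exact congrArg (· • x) this
    rw [h1, holonomy_loop]
    have h2 := hφ (Path.Homotopic.Quotient.mk (periodLoop w'))
    rw [winding_periodLoop] at h2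
    have h3 : evPi k x (Path.Homotopic.Quotient.mk (periodLoop w')) = Path.Homotopic.Quotient.mk
        (((periodLoop w').map (ev k x).continuous).cast (one_smul _ x).symm
          (one_smul _ x).symm) := FundamentalGroup.mapOfEq_apply _ _ _
    rw [← h3, h2]
    rfl
  -- Subtracting the linear part makes G periodic, so it descends to the function g on the torus.
  have hGper : ∀ v v', expMap v = expMap v' → G v - d • v = G v' - d • v' := by
    intro v v' hvv
    have hw : expMap (v' - v) = 1 := by
      have := expMap_add (v' - v) v
      rw [sub_add_cancel, ← hvv] at this
      exact (mul_eq_right.1 this.symm)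
    have h1 := orbitIntegral_add c x hw v
    rw [sub_add_cancel, hper _ hw] at h1
    have h2 : orbitExp k x v = orbitExp k x v' := by simp [orbitExp, hvv]
    simp only [G, h1, h2, smul_sub]
    abel
  let E : C(Fin k → ℝ, Torus k) := ⟨expMap, continuous_expMap⟩
  have hE : IsQuotientMap E := isQuotientMap_expMap
  let G' : C(Fin k → ℝ, Fin k → ℝ) := ⟨fun v => G v - d • v, by fun_prop⟩
  have hG' : Function.FactorsThrough G' E := fun v v' => hGper v v'
  let g := hE.lift G' hG'
  have hg : ∀ v, g (expMap v) = G v - d • v := fun v => congr($(hE.lift_comp G' hG') v)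
  refine ⟨d, hd, ⟨fun y => expMap (F y), hf⟩, g, fun v => ?_⟩
  rw [hg, sub_add_cancel]
  change expMap (F (orbitExp k x v)) = expMap (F (orbitExp k x v) + orbitIntegral c x v)
  rw [expMap_add, orbitIntegral, hc, mul_one]

/-- Up to homotopy, a power map of the torus factors through the orbit map. -/
theorem homotopic_torusPow {d : ℕ} {x : M} {f : C(M, Torus k)} {g : C(Torus k, Fin k → ℝ)}
    (h : ∀ v, f (expMap v • x) = expMap (g (expMap v) + d • v)) :
    (f.comp (ev k x)).Homotopic (torusPow k d) :=
  -- The term g takes values in a vector space, so it can be scaled to zero.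
  ⟨{ toFun := fun q => expMap ((1 - (q.1 : ℝ)) • g q.2) * q.2 ^ d
     continuous_toFun := by
       refine (continuous_expMap.comp ?_).mul (by fun_prop)
       fun_prop
     map_zero_left := fun t => by
       obtain ⟨v, rfl⟩ := expMap_surjective t
       simp [ev, h, expMap_add, ← expMap_nsmul]
     map_one_left := fun t => by simp [torusPow, expMap_zero] }⟩

end TorusMap

/-! ### The dimension bound k ≤ n -/

/-- The orbit of `x` contains no fixed line. -/
theorem eq_zero_of_line_fixed {k : ℕ} {M : Type} [TopologicalSpace M]
    [MulAction (Torus k) M] {d : ℕ} (hd : d ≠ 0) {x : M} {f : C(M, Torus k)}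
    {g : C(Torus k, Fin k → ℝ)} (h : ∀ v, f (expMap v • x) = expMap (g (expMap v) + d • v))
    {v : Fin k → ℝ} (hv : ∀ t : ℝ, expMap (t • v) • x = x) : v = 0 := by
  have hcont : Continuous fun t : ℝ => g (expMap (t • v)) + d • t • v := by
    have := continuous_expMap (k := k)
    fun_prop
  -- Both sides lift the constant f x and agree at t = 0.
  have hconst := eq_of_expMap_comp_eq hcont (continuous_const (y := g 1))
    (fun t => by
      rw [← h, hv]
      have := h 0
      rw [expMap_zero, one_smul, smul_zero, add_zero] at this
      exact this) 0 (by simp [expMap_zero])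
  obtain ⟨C, hC⟩ := (isCompact_range g.continuous).isBounded.exists_norm_le
  have hb : ∀ t : ℝ, ‖(d * t) • v‖ ≤ C + C := fun t => by
    have := congrFun hconst t
    have h1 : (d * t) • v = g 1 - g (expMap (t • v)) := by
      rw [← this, mul_smul, Nat.cast_smul_eq_nsmul]; abel
    rw [h1]
    exact (norm_sub_le _ _).trans (add_le_add (hC _ ⟨_, rfl⟩) (hC _ ⟨_, rfl⟩))
  by_contra hv0
  have hd' : (d : ℝ) ≠ 0 := by exact_mod_cast hd
  have hn : ‖v‖ ≠ 0 := norm_ne_zero_iff.2 hv0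
  -- This t makes the norm of (d t) v equal to 2C + 1, beyond the bound 2C.
  have := hb ((C + C + 1) / (d * ‖v‖))
  have heq : (d : ℝ) * ((C + C + 1) / (d * ‖v‖)) = (C + C + 1) / ‖v‖ := by field_simp
  rw [heq, norm_smul, norm_div, norm_norm, div_mul_cancel₀ _ hn, Real.norm_eq_abs] at this
  linarith [le_abs_self (C + C + 1)]

/-- A small ball in a chart is contractible; this supplies the cover on which the primitive is
built. -/
theorem exists_isSimplyConnected_nhd {E M : Type*} [NormedAddCommGroup E] [NormedSpace ℝ E]
    [TopologicalSpace M] [ChartedSpace E M] (x : M) :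
    ∃ U : Set M, IsOpen U ∧ x ∈ U ∧ IsSimplyConnected U := by
  let e := chartAt E x
  have hx : e x ∈ e.target := e.map_source (mem_chart_source E x)
  obtain ⟨ε, hε, hball⟩ := Metric.isOpen_iff.1 e.open_target _ hx
  have hsub : Metric.ball (e x) ε ⊆ e.symm.source := hball
  refine ⟨e.symm '' Metric.ball (e x) ε, e.symm.isOpen_image_of_subset_source Metric.isOpen_ball
    hsub, ⟨e x, Metric.mem_ball_self hε, e.left_inv (mem_chart_source E x)⟩, ?_⟩
  have : ContractibleSpace (Metric.ball (e x) ε) := Metric.contractibleSpace_ball hε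
  have : ContractibleSpace (e.symm '' Metric.ball (e x) ε) :=
    (e.symm.homeomorphOfImageSubsetSource hsub rfl).symm.contractibleSpace
  exact SimplyConnectedSpace.ofContractible _

theorem mdifferentiableAt_expMap {k : ℕ} (v : Fin k → ℝ) :
    MDifferentiableAt 𝓘(ℝ, Fin k → ℝ) (torusModel k) expMap v := by
  have hi : ∀ i, MDifferentiableAt 𝓘(ℝ, Fin k → ℝ) (𝓡 1)
      (fun v : Fin k → ℝ => Circle.exp (v i)) v := fun i =>
    ((contMDiff_circleExp (m := 1)).mdifferentiableAt one_ne_zero (x := v i)).comp v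
      (ContinuousLinearMap.proj (R := ℝ) (φ := fun _ : Fin k => ℝ) i).mdifferentiableAt
  rw [mdifferentiableAt_iff]
  refine ⟨continuous_expMap.continuousAt, ?_⟩
  have := fun i => ((mdifferentiableAt_iff _ _).1 (hi i)).2
  rw [differentiableWithinAt_pi]
  exact this

section Curve

variable {n : ℕ} {M : Type*} [TopologicalSpace M] [ChartedSpace (EuclideanSpace ℝ (Fin n)) M]
  [IsManifold (𝓡 n) ∞ M]

/-- A curve in a manifold with vanishing derivative is constant. -/
theorem eq_of_hasMFDerivAt_zero {c : ℝ → M}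
    (hc : ∀ t, HasMFDerivAt 𝓘(ℝ, ℝ) (𝓡 n) c t 0) (s t : ℝ) : c s = c t := by
  have hcont : Continuous c := continuous_iff_continuousAt.2 fun t => (hc t).continuousAt
  have : IsLocallyConstant c := by
    rw [IsLocallyConstant.iff_eventually_eq]
    intro t₀
    let e := extChartAt (𝓡 n) (c t₀)
    obtain ⟨ε, hε, hball⟩ := Metric.mem_nhds_iff.1 (hcont.continuousAt.preimage_mem_nhds
      (extChartAt_source_mem_nhds (I := 𝓡 n) (c t₀)))
    have hd : ∀ u ∈ Metric.ball t₀ ε, HasFDerivAt (e ∘ c) (0 : ℝ →L[ℝ] _) u := by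
      intro u hu
      have h1 : HasMFDerivAt (𝓡 n) 𝓘(ℝ, EuclideanSpace ℝ (Fin n)) e (c u) _ :=
        (mdifferentiableAt_extChartAt (I := 𝓡 n) (by
          rw [← extChartAt_source (𝓡 n)]; exact hball hu)).hasMFDerivAt
      have h2 := h1.comp u (hc u)
      rw [ContinuousLinearMap.comp_zero] at h2
      exact h2.hasFDerivAt
    have hconst : ∀ u ∈ Metric.ball t₀ ε, (e ∘ c) u = (e ∘ c) t₀ := fun u hu =>
      Metric.isOpen_ball.is_const_of_fderiv_eq_zero (convex_ball t₀ ε).isPreconnected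
        (fun u hu => (hd u hu).differentiableAt.differentiableWithinAt)
        (fun u hu => (hd u hu).fderiv) hu (Metric.mem_ball_self hε)
    filter_upwards [Metric.ball_mem_nhds t₀ hε] with u hu
    exact e.injOn (hball hu) (mem_extChartAt_source _) (hconst u hu)
  exact this.apply_eq_of_preconnectedSpace s t

end Curve

section Orbit

variable {k n : ℕ} {M : Type} [TopologicalSpace M] [ChartedSpace (EuclideanSpace ℝ (Fin n)) M]
  [MulAction (Torus k) M] [ContinuousSMul (Torus k) M]
  [ContMDiffSMul (torusModel k) (𝓡 n) ∞ (Torus k) M]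

theorem mdifferentiableAt_orbitExp (x : M) (v : Fin k → ℝ) :
    MDifferentiableAt 𝓘(ℝ, Fin k → ℝ) (𝓡 n) (orbitExp k x) v := by
  have h1 : ContMDiff (torusModel k) (𝓡 n) ∞ fun t : Torus k => t • x :=
    contMDiff_id.smul (I := torusModel k) contMDiff_const
  exact (h1.mdifferentiableAt (by simp)).comp v (mdifferentiableAt_expMap v)

/-- If the torus has larger dimension than the manifold, then each point is fixed by a line. -/
theorem exists_fixed_line [IsManifold (𝓡 n) ∞ M] (hkn : n < k) (x : M) :
    ∃ v : Fin k → ℝ, v ≠ 0 ∧ ∀ t : ℝ, expMap (t • v) • x = x := by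
  let A : (Fin k → ℝ) →L[ℝ] EuclideanSpace ℝ (Fin n) :=
    mfderiv 𝓘(ℝ, Fin k → ℝ) (𝓡 n) (orbitExp k x) 0
  have hker : A.toLinearMap.ker ≠ ⊥ := LinearMap.ker_ne_bot_of_finrank_lt (by simpa using hkn)
  obtain ⟨v, hv, hv0⟩ := Submodule.exists_mem_ne_zero_of_ne_bot hker
  refine ⟨v, hv0, ?_⟩
  let L : ℝ →L[ℝ] (Fin k → ℝ) := ContinuousLinearMap.toSpanSingleton ℝ v
  let c : ℝ → M := fun t => orbitExp k x (L t)
  have hA : HasMFDerivAt 𝓘(ℝ, Fin k → ℝ) (𝓡 n) (orbitExp k x) (L 0) A := by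
    rw [map_zero]
    exact (mdifferentiableAt_orbitExp x 0).hasMFDerivAt
  have hc0 : HasMFDerivAt 𝓘(ℝ, ℝ) (𝓡 n) c 0 (0 : ℝ →L[ℝ] EuclideanSpace ℝ (Fin n)) := by
    have h1 := hA.comp 0 L.hasMFDerivAt
    have h2 : A.comp L = 0 := by
      ext1
      simpa [L] using hv
    exact h1.congr_mfderiv h2
  -- Since c s = expMap (t v) • c (s − t), the vanishing derivative at 0 is carried to every t by
  -- the group action.
  have hc : ∀ t, HasMFDerivAt 𝓘(ℝ, ℝ) (𝓡 n) c t (0 : ℝ →L[ℝ] EuclideanSpace ℝ (Fin n)) := by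
    intro t
    have hsub : HasMFDerivAt 𝓘(ℝ, ℝ) 𝓘(ℝ, ℝ) (fun s : ℝ => s - t) t (ContinuousLinearMap.id ℝ ℝ) :=
      ((hasFDerivAt_id t).sub_const t).hasMFDerivAt
    have hsmul : HasMFDerivAt (𝓡 n) (𝓡 n) (fun y : M => expMap (L t) • y) (c (t - t)) _ :=
      ((ContMDiffSMul.contMDiff_const_smul (I := torusModel k) (n := ∞)
        (expMap (L t))).mdifferentiableAt (by simp)).hasMFDerivAt
    have hc0' : HasMFDerivAt 𝓘(ℝ, ℝ) (𝓡 n) c (t - t)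
        (0 : ℝ →L[ℝ] EuclideanSpace ℝ (Fin n)) := by
      rw [sub_self]; exact hc0
    have h1 := HasMFDerivAt.comp (f := fun s : ℝ => s - t) t (hsmul.comp (t - t) hc0') hsub
    have hz : ∀ B : EuclideanSpace ℝ (Fin n) →L[ℝ] EuclideanSpace ℝ (Fin n),
        (B.comp (0 : ℝ →L[ℝ] EuclideanSpace ℝ (Fin n))).comp (ContinuousLinearMap.id ℝ ℝ) = 0 :=
      fun B => by rw [ContinuousLinearMap.comp_zero, ContinuousLinearMap.zero_comp]
    refine (h1.congr_mfderiv (hz _)).congr_of_eventuallyEq (Filter.Eventually.of_forall fun s => ?_)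
    simp only [c, orbitExp, ContinuousMap.coe_mk, Function.comp_apply, smul_smul, ← expMap_add,
      ← map_add, add_sub_cancel]
  intro t
  have := eq_of_hasMFDerivAt_zero hc t 0
  simpa [c, orbitExp, L, expMap_zero] using this

end Orbit

theorem ev_homotopic {k : ℕ} {M : Type} [TopologicalSpace M] [MulAction (Torus k) M]
    [ContinuousSMul (Torus k) M] {x y : M} (p : Path x y) : (ev k x).Homotopic (ev k y) :=
  ⟨{ toFun := fun q => q.2 • p q.1
     continuous_toFun := by fun_prop
     map_zero_left := fun t => by simp [ev]
     map_one_left := fun t => by simp [ev] }⟩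

theorem two_pow_le_sum_of_choose_le {k n : ℕ} (hkn : k ≤ n) {b : ℕ → Cardinal}
    (hb : ∀ j, (k.choose j : Cardinal) ≤ b j) :
    (2 : Cardinal) ^ k ≤ ∑ j ∈ Finset.range (n + 1), b j := by
  have h : (2 : Cardinal) ^ k = ∑ j ∈ Finset.range (k + 1), (k.choose j : Cardinal) := by
    rw [← Nat.cast_sum, Nat.sum_range_choose, Nat.cast_pow, Nat.cast_ofNat]
  rw [h]
  refine (Finset.sum_le_sum_of_subset ?_).trans (Finset.sum_le_sum fun j _ => hb j)
  exact Finset.range_mono (by omega)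

end TorusAction

end

/-! ### Conclusion -/

open TorusAction

theorem theorem2p2 (k n : ℕ) (M : Type) [TopologicalSpace M] [T2Space M] [CompactSpace M]
    [ConnectedSpace M] [ChartedSpace (EuclideanSpace ℝ (Fin n)) M] [IsManifold (𝓡 n) ∞ M]
    [MulAction (TorusAction.Torus k) M] [ContinuousSMul (TorusAction.Torus k) M]
    [ContMDiffSMul (TorusAction.torusModel k) (𝓡 n) ∞ (TorusAction.Torus k) M]
    (x₀ : M) (h : TorusAction.IsInjectiveSplitting k x₀) :
    (∀ (x : M) (j : ℕ),
        Function.Injective (TorusAction.homologyMap j (TorusAction.ev k x))) ∧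
      (∀ j : ℕ, (k.choose j : Cardinal) ≤ TorusAction.betti j M) ∧
      (2 : Cardinal) ^ k ≤ ∑ j ∈ Finset.range (n + 1), TorusAction.betti j M ∧
      (∀ x : M, TorusAction.IsHomologicallyInjective k x) := by
  have : LocallyPathConnectedSpace M :=
    ChartedSpace.locallyPathConnectedSpace (EuclideanSpace ℝ (Fin n)) M
  have : PathConnectedSpace M := PathConnectedSpace.of_locallyPathConnectedSpace
  obtain ⟨d, hd, f, g, hfg⟩ := exists_torus_map
    (exists_isSimplyConnected_nhd (E := EuclideanSpace ℝ (Fin n))) h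
  have hT := isTorusLike_torusPow k hd
  have hinj : ∀ (x : M) (j : ℕ), Function.Injective (homologyMap j (ev k x)) := by
    intro x j
    have hcomp := homologyMap_eq_of_homotopic j (homotopic_torusPow hfg)
    rw [homologyMap_comp] at hcomp
    have h₀ : Function.Injective (homologyMap j f ∘ₗ homologyMap j (ev k x₀)) := by
      rw [hcomp]
      exact hT.injective j
    -- All orbit maps are homotopic because M is path connected, so the base point x₀ suffices.
    rw [homologyMap_eq_of_homotopic j (ev_homotopic (PathConnectedSpace.somePath x x₀))]
    exact Function.Injective.of_comp (f := homologyMap j f) h₀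
  have hbetti : ∀ j : ℕ, (k.choose j : Cardinal) ≤ betti j M := fun j => by
    rw [← hT.rank_eq j]
    exact LinearMap.rank_le_of_injective _ (hinj x₀ j)
  have hkn : k ≤ n := by
    by_contra! hlt
    obtain ⟨v, hv0, hv⟩ := exists_fixed_line hlt x₀
    exact hv0 (eq_zero_of_line_fixed hd hfg hv)
  exact ⟨hinj, hbetti, two_pow_le_sum_of_choose_le hkn hbetti, fun x => hinj x 1⟩
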